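/- Let $1\le k\le d$. Let $V_k(\mathbb R^d)=\{A\in\mathbb R^{d\times k}: A^{\top}A=\mathbf 1_{k\times k}\}$ be the Stiefel manifold, $\sigma^d_k$ its uniform distribution (the unique Borel probability measure on it that is invariant under left multiplication by $O(d)$), and let $\mathrm{TB}^d_k:C(\mathbb R^k)\to C(\mathbb R^d)$, $\mathrm{TB}^d_k(f)(t)=\int_{V_k(\mathbb R^d)} f(A^{\top}t)\,\sigma^d_k(dA)$, be the turning bands operator. Let $(\Omega,\mathcal A,\nu)$ be an s-finite measure space and $V:\mathbb R^k\times\Omega\to[0,\infty)$, $(t,\omega)\mapsto V_t(\omega)$, a jointly measurable function with $\int_\Omega V_t\,d\nu=1$ for every $t\in\mathbb R^k$. Let $(U_n,\omega_n)_{n\in\mathbb N}$ be an enumerated Poisson point process on $[0,\infty)\times\Omega$ with intensity $u^{-2}du\,\nu(d\omega)$ and put $$X_t=\sup_{n}U_nV_t(\omega_n),\qquad t\in\mathbb R^k .$$ Assume that the process $X$ is stochastically continuous. Let $(U_n,\omega_n,A_n)_{n\in\mathbb N}$ be an enumerated Poisson point process (possibly on another probability space) on $[0,\infty)\times\Omega\times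 V_k(\mathbb R^d)$ with intensity $u^{-2}du\,\nu(d\omega)\,\sigma^d_k(dA)$ and put $$Y_t=\sup_{n}U_nV_{A_n^{\top}t}(\omega_n),\qquad t\in\mathbb R^d .$$ (For each $t$, this supremum is almost surely finite.) For a stationary process $Z$ whose one-dimensional marginal distribution has upper endpoint $\tau_0$, the tail correlation function (TCF) of $Z$ is $\chi^{(Z)}(t)=\lim_{\tau\uparrow\tau_0}\mathbb P(Z_t\ge\tau\mid Z_0\ge\tau)$, provided the limits exist. Then: a) If $X$ is stationary, then $Y$ is stationary. b) For every $G\in O(d)$, the processes $(Y_{Gt})_{t\in\mathbb R^d}$ and $(Y_t)_{t\in\mathbb R^d}$ have the same law. c) If $X$ is stationary, then the TCFs $\chi^{(X)}$ and $\chi^{(Y)}$ exist, $\chi^{(X)}$ is continuous, $\chi^{(Y)}$ is radial (that is, $\chi^{(Y)}(t)$ depends on $\|t\|$ only), and $$\chi^{(Y)}=\mathrm{TB}^d_k\bigl(\chi^{(X)}\bigr).$$ -/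

import Mathlib

open MeasureTheory ProbabilityTheory Filter Topology
open scoped NNReal ENNReal

/-! ### The Stiefel manifold and its uniform distribution -/

/-- The Stiefel manifold `V_k(ℝ^d)`: real `d × k` matrices `A` with `Aᵀ A = 1`,
as a topological subspace of the space of matrices. -/
def Stiefel (d k : ℕ) : Type :=
  {A : Matrix (Fin d) (Fin k) ℝ // A.transpose * A = 1}

instance (d k : ℕ) : TopologicalSpace (Stiefel d k) :=
  inferInstanceAs (TopologicalSpace {A : Matrix (Fin d) (Fin k) ℝ // A.transpose * A = 1})

instance (d k : ℕ) : MeasurableSpace (Stiefel d k) := borel _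

instance (d k : ℕ) : BorelSpace (Stiefel d k) := ⟨rfl⟩

/-- The orthogonal group `O(d)`. -/
abbrev OrthGroup (d : ℕ) : Type := Matrix.orthogonalGroup (Fin d) ℝ

instance (d : ℕ) : MeasurableSpace (OrthGroup d) := borel _

instance (d : ℕ) : BorelSpace (OrthGroup d) := ⟨rfl⟩

lemma abs_entry_le_one_of_transpose_mul {d k : ℕ} {A : Matrix (Fin d) (Fin k) ℝ}
    (hA : A.transpose * A = 1) (i : Fin d) (j : Fin k) : A i j ∈ Set.Icc (-1 : ℝ) 1 := by
  have h : ∑ x, A x j * A x j = 1 := by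
    have := congrFun (congrFun hA j) j
    simpa [Matrix.mul_apply] using this
  have h2 : A i j * A i j ≤ ∑ x, A x j * A x j :=
    Finset.single_le_sum (f := fun x => A x j * A x j) (fun x _ => mul_self_nonneg _)
      (Finset.mem_univ i)
  constructor <;> nlinarith

lemma isCompact_transpose_mul_eq_one (d k : ℕ) :
    IsCompact {A : Matrix (Fin d) (Fin k) ℝ | A.transpose * A = 1} := by
  have hK : IsCompact (Set.univ.pi fun _ : Fin d => Set.univ.pi fun _ : Fin k =>
      Set.Icc (-1 : ℝ) 1) :=
    isCompact_univ_pi fun _ => isCompact_univ_pi fun _ => isCompact_Icc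
  refine IsCompact.of_isClosed_subset (s := (Set.univ.pi fun _ : Fin d =>
    Set.univ.pi fun _ : Fin k => Set.Icc (-1 : ℝ) 1 : Set (Matrix (Fin d) (Fin k) ℝ))) hK ?_ ?_
  · exact isClosed_eq (by fun_prop) continuous_const
  · intro A hA i _ j _
    exact abs_entry_le_one_of_transpose_mul hA i j

instance (d k : ℕ) : CompactSpace (Stiefel d k) :=
  isCompact_iff_compactSpace.mp (isCompact_transpose_mul_eq_one d k)

instance (d : ℕ) : CompactSpace (OrthGroup d) := by
  refine isCompact_iff_compactSpace.mp ?_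
  convert isCompact_transpose_mul_eq_one d d using 1
  ext A
  exact Matrix.mem_orthogonalGroup_iff' (Fin d) ℝ

/-- The action of `O(d)` on the Stiefel manifold by matrix multiplication from the left. -/
def OrthGroup.act {d k : ℕ} (G : OrthGroup d) (A : Stiefel d k) : Stiefel d k :=
  ⟨G.1 * A.1, by
    have hG : G.1.transpose * G.1 = 1 := (Matrix.mem_orthogonalGroup_iff' (Fin d) ℝ).mp G.2
    rw [Matrix.transpose_mul, Matrix.mul_assoc, ← Matrix.mul_assoc G.1.transpose, hG,
      Matrix.one_mul, A.2]⟩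

/-- The standard `k`-frame `(e_1, …, e_k)` in `ℝ^d`. -/
def stdFrame {d k : ℕ} (hkd : k ≤ d) : Stiefel d k :=
  ⟨Matrix.of fun i j => if i = Fin.castLE hkd j then 1 else 0, by
    ext i j
    simp [Matrix.mul_apply, Matrix.one_apply, (Fin.castLE_injective hkd).eq_iff, @eq_comm _ j i]⟩

lemma OrthGroup.continuous_act_left {d k : ℕ} (A : Stiefel d k) :
    Continuous fun G : OrthGroup d => G.act A :=
  Continuous.subtype_mk (continuous_subtype_val.matrix_mul continuous_const) _

lemma OrthGroup.continuous_act_right {d k : ℕ} (G : OrthGroup d) :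
    Continuous fun A : Stiefel d k => G.act A :=
  Continuous.subtype_mk (continuous_const.matrix_mul continuous_subtype_val) _

/-- The uniform distribution `σ^d_k` on the Stiefel manifold, i.e. its unique `O(d)`-invariant
Borel probability measure: the distribution of `G · (e_1, …, e_k)` where `G` is distributed
according to the normalized Haar measure of the compact group `O(d)`. -/
noncomputable def stiefelUniform {d k : ℕ} (hkd : k ≤ d) : Measure (Stiefel d k) :=
  (Measure.haarMeasure (⊤ : TopologicalSpace.PositiveCompacts (OrthGroup d))).map
    fun G => G.act (stdFrame hkd)

instance {d k : ℕ} (hkd : k ≤ d) : IsProbabilityMeasure (stiefelUniform hkd) := by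
  have : IsProbabilityMeasure
      (Measure.haarMeasure (⊤ : TopologicalSpace.PositiveCompacts (OrthGroup d))) :=
    ⟨Measure.haarMeasure_self⟩
  exact Measure.isProbabilityMeasure_map (OrthGroup.continuous_act_left _).measurable.aemeasurable

lemma stiefelUniform_map_act {d k : ℕ} (hkd : k ≤ d) (G : OrthGroup d) :
    (stiefelUniform hkd).map (fun A => G.act A) = stiefelUniform hkd := by
  unfold stiefelUniform
  rw [Measure.map_map (OrthGroup.continuous_act_right G).measurable
    (OrthGroup.continuous_act_left _).measurable]
  conv_rhs => rw [← map_mul_left_eq_self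
    (Measure.haarMeasure (⊤ : TopologicalSpace.PositiveCompacts (OrthGroup d))) G]
  rw [Measure.map_map (OrthGroup.continuous_act_left _).measurable (measurable_const_mul G)]
  congr 1
  funext H
  exact Subtype.ext (Matrix.mul_assoc _ _ _).symm

/-! ### The turning bands operator -/

/-- The vector `Aᵀ t ∈ ℝ^k` for a frame `A ∈ V_k(ℝ^d)` and `t ∈ ℝ^d`. -/
noncomputable def Stiefel.proj {d k : ℕ} (A : Stiefel d k) (t : EuclideanSpace ℝ (Fin d)) :
    EuclideanSpace ℝ (Fin k) :=
  WithLp.toLp 2 (A.1.transpose.mulVec t.ofLp)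

lemma Stiefel.continuous_proj (d k : ℕ) :
    Continuous fun p : EuclideanSpace ℝ (Fin d) × Stiefel d k => p.2.proj p.1 := by
  have h : Continuous fun p : EuclideanSpace ℝ (Fin d) × Stiefel d k => p.2.1 :=
    continuous_subtype_val.comp continuous_snd
  unfold Stiefel.proj
  exact (PiLp.continuous_toLp 2 _).comp
    (h.matrix_transpose.matrix_mulVec ((PiLp.continuous_ofLp 2 _).comp continuous_fst))

/-- The turning bands operator `TB^d_k : C(ℝ^k) → C(ℝ^d)`,
`TB^d_k(f)(t) = ∫ f(Aᵀ t) σ^d_k(dA)`. -/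
noncomputable def turningBands {d k : ℕ} (hkd : k ≤ d) (f : C(EuclideanSpace ℝ (Fin k), ℝ)) :
    C(EuclideanSpace ℝ (Fin d), ℝ) where
  toFun t := ∫ A, f (A.proj t) ∂(stiefelUniform hkd)
  continuous_toFun := by
    have h : Continuous (Function.uncurry fun (t : EuclideanSpace ℝ (Fin d)) (A : Stiefel d k) =>
        f (A.proj t)) := f.continuous.comp (Stiefel.continuous_proj d k)
    simpa using continuous_parametric_integral_of_continuous (μ := stiefelUniform hkd) h
      isCompact_univ

/-! ### Poisson point processes and max-stable processes -/

/-- The number of points `ξ n s`, `n ∈ ℕ`, (counted with multiplicity) lying in `B`. -/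
noncomputable def pointCount {S E : Type*} (ξ : ℕ → S → E) (B : Set E) (s : S) : ℕ∞ :=
  Set.encard {n | ξ n s ∈ B}

/-- `ξ 0, ξ 1, …` is an enumeration of the points of a Poisson point process on `E` with
intensity measure `μ`: the number of points in `B` is Poisson distributed with parameter `μ B`
(almost surely infinite if `μ B = ∞`), and the numbers of points in finitely many pairwise
disjoint sets are independent. -/
structure IsPoissonPointProcess {S E : Type*} [MeasurableSpace S] [MeasurableSpace E]
    (P : Measure S) (ξ : ℕ → S → E) (μ : Measure E) : Prop where
  measurable : ∀ n, Measurable (ξ n)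
  poisson : ∀ B, MeasurableSet B → μ B ≠ ∞ →
    HasLaw (pointCount ξ B) ((poissonMeasure (μ B).toNNReal).map ((↑) : ℕ → ℕ∞)) P
  infinite : ∀ B, MeasurableSet B → μ B = ∞ → ∀ᵐ s ∂P, pointCount ξ B s = ⊤
  indep : ∀ (m : ℕ) (B : Fin m → Set E), (∀ i, MeasurableSet (B i)) →
    Pairwise (fun i j => Disjoint (B i) (B j)) → iIndepFun (fun i => pointCount ξ (B i)) P

/-- The measure `u⁻² du` on `[0, ∞)` (with no mass at `0`), obtained by transporting the
measure with density `u⁻²` on `(0, ∞) ⊆ ℝ` to the type `ℝ≥0`. -/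
noncomputable def invSqMeasure : Measure ℝ≥0 :=
  ((volume.restrict (Set.Ioi (0 : ℝ))).withDensity
    fun u => ENNReal.ofReal (u ^ 2)⁻¹).map Real.toNNReal

/-- The process `t ↦ sup_n U_n V_t(ω_n)`, where `ξ n = (U_n, ω_n)`. -/
noncomputable def spectralProcess {T S Ω : Type*} (V : T → Ω → ℝ≥0) (ξ : ℕ → S → ℝ≥0 × Ω)
    (t : T) (s : S) : ℝ :=
  ⨆ n, ((ξ n s).1 : ℝ) * (V t (ξ n s).2 : ℝ)

/-- The spectral functions `t ↦ V_{Aᵀ t}(ω)` on the space of pairs `(ω, A)`. -/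
noncomputable def turningBandsSpectral {d k : ℕ} {Ω : Type*}
    (V : EuclideanSpace ℝ (Fin k) → Ω → ℝ≥0) :
    EuclideanSpace ℝ (Fin d) → Ω × Stiefel d k → ℝ≥0 :=
  fun t p => V (p.2.proj t) p.1

/-! ### Stationarity, stochastic continuity and tail correlation functions -/

/-- Two families of real random variables with the same index set have the same law, as
random elements of the product measurable space `T → ℝ`. -/
def SameLaw {T S S' : Type*} [MeasurableSpace S] [MeasurableSpace S'] (P : Measure S)
    (P' : Measure S') (X : T → S → ℝ) (Y : T → S' → ℝ) : Prop :=
  IdentDistrib (fun s t => X t s) (fun s t => Y t s) P P'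

/-- Strict stationarity: `(X_{t+h})_t` has the same law as `(X_t)_t`, for every shift `h`. -/
def IsStationaryProcess {d : ℕ} {S : Type*} [MeasurableSpace S] (P : Measure S)
    (X : EuclideanSpace ℝ (Fin d) → S → ℝ) : Prop :=
  ∀ h, SameLaw P P (fun t => X (t + h)) X

/-- Stochastic continuity: `X_s → X_t` in probability as `s → t`, for every `t`. -/
def IsStochasticallyContinuous {d : ℕ} {S : Type*} [MeasurableSpace S] (P : Measure S)
    (X : EuclideanSpace ℝ (Fin d) → S → ℝ) : Prop :=
  ∀ t, TendstoInMeasure P X (𝓝 t) (X t)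

/-- The upper endpoint `sup {x | P(Z ≤ x) < 1}` of the distribution of `Z`. -/
noncomputable def upperEndpoint {S : Type*} [MeasurableSpace S] (P : Measure S) (Z : S → ℝ) :
    EReal :=
  sSup {x : EReal | P {s | (Z s : EReal) ≤ x} < 1}

/-- `χ` is the tail correlation function of `X`: for every `t` the limit of
`P(X_t ≥ τ | X_0 ≥ τ)`, as the real number `τ` increases to the upper endpoint of the marginal
distribution, exists and equals `χ t`. -/
def IsTailCorrelationFunction {d : ℕ} {S : Type*} [MeasurableSpace S] (P : Measure S)
    (X : EuclideanSpace ℝ (Fin d) → S → ℝ) (χ : EuclideanSpace ℝ (Fin d) → ℝ) : Prop :=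
  ∀ t, Tendsto (fun τ : ℝ => (ProbabilityTheory.cond P {s | τ ≤ X 0 s}).real {s | τ ≤ X t s})
    (comap ((↑) : ℝ → EReal) (𝓝[<] (upperEndpoint P (X 0)))) (𝓝 (χ t))

/-! ### Finite-dimensional laws -/

/-! A spectral process stays below levels `x i` at points `t i` exactly when no Poisson point falls
in the exceedance set, so its finite-dimensional laws are `voidProb` of the masses of such sets
(`measure_spectralProcess_le`). By Tonelli, the mass for `Y` at `t i` is the average over `A` of the
mass for `X` at the projections `Aᵀ t i` (`measure_exceedance_turningBandsSpectral`).

Both invariances follow from this average. A shift by `h` becomes a shift of `X` by `Aᵀ h` for each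
fixed `A`; a rotation `G` is absorbed by the substitution `A ↦ G A`.

For two points, the maximum is Fréchet with scale `θ = ∫ max (V_0, V_t) dν`, and inclusion-exclusion
gives `χ = 2 - θ`. Averaging over `A` commutes with `θ ↦ 2 - θ`, which yields the turning bands
identity. Stochastic continuity makes `θ` continuous. -/

lemma measure_pi_ext_of_Iic {ι : Type*} [Finite ι] {μ ν : Measure (ι → ℝ)} [IsFiniteMeasure μ]
    [IsFiniteMeasure ν] (huniv : μ Set.univ = ν Set.univ)
    (h : ∀ x : ι → ℝ, μ {y | ∀ i, y i ≤ x i} = ν {y | ∀ i, y i ≤ x i}) : μ = ν := by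
  have hspan : IsCountablySpanning (Set.range (Set.Iic : ℝ → Set ℝ)) := by
    refine ⟨fun n : ℕ => Set.Iic (n : ℝ), fun n => ⟨n, rfl⟩, ?_⟩
    ext y
    simpa using exists_nat_ge y
  have hpi : IsPiSystem (Set.range (Set.Iic : ℝ → Set ℝ)) := by
    simpa using isPiSystem_image_Iic (Set.univ : Set ℝ)
  refine ext_of_generate_finite _ (generateFrom_eq_pi (fun _ : ι => ?_) fun _ => hspan).symm
    (IsPiSystem.pi fun _ : ι => hpi) ?_ huniv
  · rw [← borel_eq_generateFrom_Iic, BorelSpace.measurable_eq (α := ℝ)]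
  · rintro _ ⟨s, hs, rfl⟩
    choose x hx using fun i => hs i (Set.mem_univ i)
    have : Set.pi Set.univ s = {y : ι → ℝ | ∀ i, y i ≤ x i} := by
      ext y
      simp [← hx]
    rw [this, h]

lemma sameLaw_of_forall_measure_le {T S : Type*} [MeasurableSpace S] {P : Measure S}
    [IsFiniteMeasure P] {X Y : T → S → ℝ} (hX : ∀ t, Measurable (X t)) (hY : ∀ t, Measurable (Y t))
    (h : ∀ (I : Finset T) (x : I → ℝ),
      P {s | ∀ i : I, X i s ≤ x i} = P {s | ∀ i : I, Y i s ≤ x i}) : SameLaw P P X Y := by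
  have hX' : Measurable fun s t => X t s := measurable_pi_lambda _ hX
  have hY' : Measurable fun s t => Y t s := measurable_pi_lambda _ hY
  refine ⟨hX'.aemeasurable, hY'.aemeasurable, ?_⟩
  refine (map_eq_iff_forall_finset_map_restrict_eq hX'.aemeasurable hY'.aemeasurable).2 fun I => ?_
  have hXI : Measurable fun s => I.restrict (X · s) := (Finset.measurable_restrict I).comp hX'
  have hYI : Measurable fun s => I.restrict (Y · s) := (Finset.measurable_restrict I).comp hY'
  refine measure_pi_ext_of_Iic ?_ fun x => ?_
  · rw [Measure.map_apply hXI .univ, Measure.map_apply hYI .univ]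
    simp
  · have hm : MeasurableSet {y : I → ℝ | ∀ i, y i ≤ x i} := by
      simp only [Set.ofPred_forall]
      exact .iInter fun i => measurableSet_le (measurable_pi_apply i) measurable_const
    rw [Measure.map_apply hXI hm, Measure.map_apply hYI hm]
    exact h I x

lemma SameLaw.measure_le_eq {T S S' ι : Type*} [Countable ι] [MeasurableSpace S]
    [MeasurableSpace S'] {P : Measure S} {P' : Measure S'} {X : T → S → ℝ} {Y : T → S' → ℝ}
    (h : SameLaw P P' X Y) (t : ι → T) (x : ι → ℝ) :
    P {s | ∀ i, X (t i) s ≤ x i} = P' {s | ∀ i, Y (t i) s ≤ x i} := by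
  refine h.measure_mem_eq (s := {y : T → ℝ | ∀ i, y (t i) ≤ x i}) ?_
  simp only [Set.ofPred_forall]
  exact .iInter fun i => measurableSet_le (measurable_pi_apply _) measurable_const

/-! ### Void probabilities of Poisson point processes -/

/-- The probability that a Poisson variable with parameter `a` vanishes. -/
noncomputable def voidProb (a : ℝ≥0∞) : ℝ≥0∞ :=
  if a = ∞ then 0 else ENNReal.ofReal (Real.exp (-a.toReal))

lemma voidProb_of_ne_top {a : ℝ≥0∞} (ha : a ≠ ∞) :
    voidProb a = ENNReal.ofReal (Real.exp (-a.toReal)) := if_neg ha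

/-- Lets masses of exceedance sets be read off from the law of `X`, infinite masses included, since
the exponential never takes the value `0`. -/
lemma voidProb_injective : Function.Injective voidProb := by
  intro a b h
  have hpos : ∀ c : ℝ≥0∞, ENNReal.ofReal (Real.exp (-c.toReal)) ≠ 0 := fun c => by
    simpa using Real.exp_pos _
  unfold voidProb at h
  split_ifs at h with ha hb hb
  · rw [ha, hb]
  · exact absurd h.symm (hpos b)
  · exact absurd h (hpos a)
  · rw [ENNReal.ofReal_eq_ofReal_iff (Real.exp_pos _).le (Real.exp_pos _).le, Real.exp_eq_exp,
      neg_inj, ENNReal.toReal_eq_toReal_iff' ha hb] at h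
    exact h

/-- All distributional information on the processes enters through this formula. -/
lemma IsPoissonPointProcess.measure_void {S E : Type*} [MeasurableSpace S] [MeasurableSpace E]
    {P : Measure S} {ξ : ℕ → S → E} {μ : Measure E} (h : IsPoissonPointProcess P ξ μ) {B : Set E}
    (hB : MeasurableSet B) : P {s | ∀ n, ξ n s ∉ B} = voidProb (μ B) := by
  have hset : {s | ∀ n, ξ n s ∉ B} = pointCount ξ B ⁻¹' {0} := by
    ext s
    simp [pointCount, Set.eq_empty_iff_forall_notMem]
  by_cases hμ : μ B = ∞
  · rw [voidProb, if_pos hμ, hset]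
    refine measure_mono_null (fun s hs => ?_) (h.infinite B hB hμ)
    simp only [Set.mem_preimage, Set.mem_singleton_iff] at hs
    simp [hs]
  · have hl := h.poisson B hB hμ
    rw [hset, ← Measure.map_apply_of_aemeasurable hl.aemeasurable (measurableSet_singleton 0),
      hl.map_eq, Measure.map_apply (measurable_of_countable _) (measurableSet_singleton 0)]
    have : ((↑) : ℕ → ℕ∞) ⁻¹' {0} = {0} := by ext n; simp
    rw [this, poissonMeasure_singleton, voidProb_of_ne_top hμ]
    simp [ENNReal.coe_toNNReal_eq_toReal]

/-! ### The measure `u⁻² du` -/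

instance : SFinite invSqMeasure := by
  unfold invSqMeasure
  infer_instance

lemma lintegral_Ioi_inv_sq {c : ℝ} (hc : 0 < c) :
    ∫⁻ u in Set.Ioi c, ENNReal.ofReal (u ^ 2)⁻¹ = ENNReal.ofReal c⁻¹ := by
  have hpow : ∀ u ∈ Set.Ioi c, (u ^ 2)⁻¹ = u ^ (-2 : ℝ) := fun u hu => by
    rw [Real.rpow_neg (hc.trans hu).le]
    norm_num
  rw [setLIntegral_congr_fun measurableSet_Ioi fun u hu => by rw [hpow u hu],
    ← ofReal_integral_eq_lintegral_ofReal
      (integrableOn_Ioi_rpow_of_lt (by norm_num : (-2 : ℝ) < -1) hc),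
    integral_Ioi_rpow_of_lt (by norm_num) hc]
  · congr 1
    rw [show (-2 : ℝ) + 1 = -1 by norm_num, Real.rpow_neg_one]
    ring
  · filter_upwards [ae_restrict_mem measurableSet_Ioi] with u hu
    exact Real.rpow_nonneg (hc.trans hu).le _

lemma invSqMeasure_Ioi {c : ℝ≥0} (hc : 0 < c) : invSqMeasure (Set.Ioi c) = (c : ℝ≥0∞)⁻¹ := by
  have hc' : (0 : ℝ) < c := hc
  rw [invSqMeasure, Measure.map_apply measurable_real_toNNReal measurableSet_Ioi]
  have hpre : Real.toNNReal ⁻¹' Set.Ioi c = Set.Ioi (c : ℝ) := by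
    ext u
    simp [Real.lt_toNNReal_iff_coe_lt]
  rw [hpre, withDensity_apply _ measurableSet_Ioi, Measure.restrict_restrict measurableSet_Ioi,
    Set.inter_eq_left.2 (Set.Ioi_subset_Ioi hc'.le), lintegral_Ioi_inv_sq hc',
    ENNReal.ofReal_inv_of_pos hc', ENNReal.ofReal_coe_nnreal]

lemma invSqMeasure_lt_mul {x : ℝ} (hx : 0 < x) (v : ℝ≥0) :
    invSqMeasure {u : ℝ≥0 | x < (u : ℝ) * v} = v / ENNReal.ofReal x := by
  lift x to ℝ≥0 using hx.le
  have hx' : 0 < x := hx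
  rcases eq_or_ne v 0 with rfl | hv
  · simp [not_lt.2 hx.le]
  · have hv' := pos_iff_ne_zero.2 hv
    have : {u : ℝ≥0 | (x : ℝ) < u * v} = Set.Ioi (x / v) := by
      ext u
      simp only [Set.mem_ofPred_eq, Set.mem_Ioi, div_lt_iff₀ hv']
      exact_mod_cast Iff.rfl
    rw [this, invSqMeasure_Ioi (div_pos hx' hv'), ENNReal.ofReal_coe_nnreal, ENNReal.coe_div hv,
      ENNReal.inv_div (by simp) (by simp [hv])]

/-- For fixed `ω` the admissible `u` form a ray beyond `x / W ω`, of mass `W ω / x`; then integrate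
over `ω`. -/
lemma invSqMeasure_prod_lt_mul {Ω : Type*} [MeasurableSpace Ω] (ν : Measure Ω) [SFinite ν]
    {W : Ω → ℝ≥0} (hW : Measurable W) {x : ℝ} (hx : 0 < x) :
    (invSqMeasure.prod ν) {p : ℝ≥0 × Ω | x < (p.1 : ℝ) * W p.2} =
      (∫⁻ ω, W ω ∂ν) / ENNReal.ofReal x := by
  rw [Measure.prod_apply_symm (measurableSet_lt measurable_const (by fun_prop))]
  simp only [Set.preimage_ofPred_eq, invSqMeasure_lt_mul hx, div_eq_mul_inv]
  rw [lintegral_mul_const _ (by fun_prop)]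

/-! ### Distributions of processes with a spectral representation -/

/-- The set of pairs `(u, ω)` with `u V_{t_i}(ω) > x_i` for some `i`. -/
def exceedance {T Ω ι : Type*} (V : T → Ω → ℝ≥0) (t : ι → T) (x : ι → ℝ) : Set (ℝ≥0 × Ω) :=
  {p | ∃ i, x i < (p.1 : ℝ) * V (t i) p.2}

lemma measurableSet_exceedance {T Ω ι : Type*} [MeasurableSpace Ω] [Countable ι]
    {V : T → Ω → ℝ≥0} (hV : ∀ t, Measurable (V t)) (t : ι → T) (x : ι → ℝ) :
    MeasurableSet (exceedance V t x) := by
  have := hV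
  simp only [exceedance, Set.ofPred_exists]
  exact .iUnion fun i => measurableSet_lt measurable_const (by fun_prop)

section Spectral

variable {T Ω S : Type*} [MeasurableSpace Ω] [MeasurableSpace S] {ν : Measure Ω}
  {V : T → Ω → ℝ≥0} {P : Measure S} {ξ : ℕ → S → ℝ≥0 × Ω}

lemma measurable_spectralProcess (hV : ∀ t, Measurable (V t))
    (hξ : IsPoissonPointProcess P ξ (invSqMeasure.prod ν)) (t : T) :
    Measurable (spectralProcess V ξ t) := by
  refine Measurable.iSup fun n => ?_
  have h1 := hξ.measurable n
  have h2 := hV t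
  fun_prop

/-- The pairwise extremal coefficient `∫ max (V_s, V_t) dν`. -/
noncomputable def extremalCoeff (ν : Measure Ω) (V : T → Ω → ℝ≥0) (s t : T) : ℝ≥0∞ :=
  ∫⁻ ω, (max (V s ω) (V t ω) : ℝ≥0) ∂ν

lemma extremalCoeff_self (t : T) : extremalCoeff ν V t t = ∫⁻ ω, V t ω ∂ν := by
  simp [extremalCoeff]

lemma extremalCoeff_le_two (hV : ∀ t, Measurable (V t)) (hV_int : ∀ t, ∫⁻ ω, V t ω ∂ν = 1)
    (s t : T) : extremalCoeff ν V s t ≤ 2 := by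
  calc extremalCoeff ν V s t ≤ ∫⁻ ω, ((V s ω : ℝ≥0∞) + V t ω) ∂ν := by
        refine lintegral_mono fun ω => ?_
        rw [← ENNReal.coe_add, ENNReal.coe_le_coe]
        exact max_le_add_of_nonneg (zero_le (a := V s ω)) (zero_le (a := V t ω))
    _ = 2 := by
        rw [lintegral_add_left (hV s).coe_nnreal_ennreal, hV_int, hV_int]
        norm_num

lemma extremalCoeff_ne_top (hV : ∀ t, Measurable (V t)) (hV_int : ∀ t, ∫⁻ ω, V t ω ∂ν = 1)
    (s t : T) : extremalCoeff ν V s t ≠ ∞ :=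
  ne_top_of_le_ne_top (by simp) (extremalCoeff_le_two hV hV_int s t)

variable [SFinite ν] [IsProbabilityMeasure P]

/-- The family is bounded by `x` with probability `exp (-c / x)`, where `c = ∫ W dν`, and this tends
to `1` as `x → ∞`. Boundedness matters because a real `⨆` over an unbounded family is `0` by
convention. -/
lemma ae_bddAbove_spectral {W : Ω → ℝ≥0} (hW : Measurable W) (hfin : ∫⁻ ω, W ω ∂ν ≠ ∞)
    (hξ : IsPoissonPointProcess P ξ (invSqMeasure.prod ν)) :
    ∀ᵐ s ∂P, BddAbove (Set.range fun n => ((ξ n s).1 : ℝ) * (W (ξ n s).2 : ℝ)) := by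
  have hmeas : MeasurableSet {s | BddAbove (Set.range fun n => ((ξ n s).1 : ℝ) * W (ξ n s).2)} := by
    refine measurableSet_bddAbove_range fun n => ?_
    have := hξ.measurable n
    fun_prop
  have hle : ∀ x : ℝ, 0 < x → ENNReal.ofReal (Real.exp (-((∫⁻ ω, W ω ∂ν).toReal / x))) ≤
      P {s | BddAbove (Set.range fun n => ((ξ n s).1 : ℝ) * W (ξ n s).2)} := by
    intro x hx
    have h := hξ.measure_void (B := {p | x < (p.1 : ℝ) * W p.2})
      (measurableSet_lt measurable_const (by fun_prop))
    rw [invSqMeasure_prod_lt_mul ν hW hx, voidProb_of_ne_top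
      (ENNReal.div_ne_top hfin (by simpa using hx)), ENNReal.toReal_div,
      ENNReal.toReal_ofReal hx.le] at h
    rw [← h]
    refine measure_mono fun s hs => ⟨x, ?_⟩
    rintro _ ⟨n, rfl⟩
    simpa using hs n
  have hlim : Tendsto (fun x : ℝ => ENNReal.ofReal (Real.exp (-((∫⁻ ω, W ω ∂ν).toReal / x))))
      atTop (𝓝 1) := by
    have : Tendsto (fun x : ℝ => (∫⁻ ω, W ω ∂ν).toReal / x) atTop (𝓝 0) :=
      tendsto_const_nhds.div_atTop tendsto_id
    have h2 := ENNReal.tendsto_ofReal ((Real.continuous_exp.tendsto _).comp this.neg)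
    simpa using h2
  have hone := le_of_tendsto hlim (eventually_gt_atTop 0 |>.mono hle)
  exact (prob_compl_eq_zero_iff hmeas).2 (le_antisymm prob_le_one hone)

/-- Off a null set all the suprema are genuine, and there the two events coincide. Levels `x i ≤ 0`
are allowed; they can give infinite mass, whence the `∞` branch of `voidProb`. -/
lemma measure_spectralProcess_le {ι : Type*} [Countable ι] (hV : ∀ t, Measurable (V t))
    (hfin : ∀ t, ∫⁻ ω, V t ω ∂ν ≠ ∞) (hξ : IsPoissonPointProcess P ξ (invSqMeasure.prod ν))
    (t : ι → T) (x : ι → ℝ) :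
    P {s | ∀ i, spectralProcess V ξ (t i) s ≤ x i} =
      voidProb ((invSqMeasure.prod ν) (exceedance V t x)) := by
  rw [← hξ.measure_void (measurableSet_exceedance hV t x)]
  refine measure_congr ?_
  have hbdd := ae_all_iff.2 fun i => ae_bddAbove_spectral (hV (t i)) (hfin (t i)) hξ
  filter_upwards [hbdd] with s hs
  refine propext ?_
  simp only [Set.mem_ofPred_eq, spectralProcess, exceedance, not_exists, not_lt]
  exact ⟨fun h n i => (ciSup_le_iff (hs i)).1 (h i) n,
    fun h i => (ciSup_le_iff (hs i)).2 fun n => h n i⟩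

lemma sameLaw_spectralProcess_comp {T' : Type*} (hV : ∀ t, Measurable (V t))
    (hfin : ∀ t, ∫⁻ ω, V t ω ∂ν ≠ ∞) (hξ : IsPoissonPointProcess P ξ (invSqMeasure.prod ν))
    (f g : T' → T)
    (h : ∀ (I : Finset T') (x : I → ℝ),
      (invSqMeasure.prod ν) (exceedance V (fun i : I => f i) x) =
        (invSqMeasure.prod ν) (exceedance V (fun i : I => g i) x)) :
    SameLaw P P (fun t => spectralProcess V ξ (f t)) (fun t => spectralProcess V ξ (g t)) := by
  refine sameLaw_of_forall_measure_le (fun t => measurable_spectralProcess hV hξ _)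
    (fun t => measurable_spectralProcess hV hξ _) fun I x => ?_
  rw [measure_spectralProcess_le hV hfin hξ (fun i : I => f i) x, h I x,
    ← measure_spectralProcess_le hV hfin hξ (fun i : I => g i) x]

lemma measureReal_max_spectralProcess_le (hV : ∀ t, Measurable (V t))
    (hV_int : ∀ t, ∫⁻ ω, V t ω ∂ν = 1) (hξ : IsPoissonPointProcess P ξ (invSqMeasure.prod ν))
    (r t : T) {x : ℝ} (hx : 0 < x) :
    P.real {s | max (spectralProcess V ξ r s) (spectralProcess V ξ t s) ≤ x} =
      Real.exp (-((extremalCoeff ν V r t).toReal / x)) := by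
  have h := measure_spectralProcess_le (t := ![r, t]) (x := fun _ => x) hV
    (fun t => by simp [hV_int]) hξ
  -- With a common level, exceeding at `r` or at `t` is exceedance by the single function `max (V r)
  -- (V t)`.
  have hexc : exceedance V ![r, t] (fun _ => x) =
      {p : ℝ≥0 × Ω | x < (p.1 : ℝ) * ((max (V r p.2) (V t p.2) : ℝ≥0) : ℝ)} := by
    ext p
    simp [exceedance, Fin.exists_fin_two, mul_max_of_nonneg]
  rw [hexc, invSqMeasure_prod_lt_mul ν ((hV r).max (hV t)) hx, ← extremalCoeff, voidProb_of_ne_top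
    (ENNReal.div_ne_top (extremalCoeff_ne_top hV hV_int r t) (by simpa using hx)),
    ENNReal.toReal_div, ENNReal.toReal_ofReal hx.le] at h
  have hset : {s | max (spectralProcess V ξ r s) (spectralProcess V ξ t s) ≤ x} =
      {s | ∀ i, spectralProcess V ξ (![r, t] i) s ≤ x} := by
    ext s
    simp [Fin.forall_fin_two]
  rw [measureReal_def, hset, h, ENNReal.toReal_ofReal (Real.exp_pos _).le]

/-- The distribution function is continuous at `x > 0`, so there is no atom. This is needed because
tail correlation is defined with `≥ τ`. -/
lemma measureReal_lt_of_frechet {Z : S → ℝ} {c : ℝ}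
    (hZ : ∀ x, 0 < x → P.real {s | Z s ≤ x} = Real.exp (-(c / x))) {x : ℝ} (hx : 0 < x) :
    P.real {s | Z s < x} = Real.exp (-(c / x)) := by
  refine le_antisymm ?_ ?_
  · rw [← hZ x hx]
    exact measureReal_mono fun s (hs : Z s < x) => hs.le
  · have hlim : Tendsto (fun y => Real.exp (-(c / y))) (𝓝[<] x) (𝓝 (Real.exp (-(c / x)))) := by
      have : ContinuousAt (fun y => Real.exp (-(c / y))) x := by
        have := hx.ne'
        fun_prop (disch := assumption)
      exact this.tendsto.mono_left nhdsWithin_le_nhds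
    refine le_of_tendsto hlim ?_
    filter_upwards [Ioo_mem_nhdsLT hx] with y hy
    rw [← hZ y hy.1]
    exact measureReal_mono fun s (hs : Z s ≤ y) => hs.trans_lt hy.2

lemma measureReal_max_spectralProcess_lt (hV : ∀ t, Measurable (V t))
    (hV_int : ∀ t, ∫⁻ ω, V t ω ∂ν = 1) (hξ : IsPoissonPointProcess P ξ (invSqMeasure.prod ν))
    (r t : T) {x : ℝ} (hx : 0 < x) :
    P.real {s | max (spectralProcess V ξ r s) (spectralProcess V ξ t s) < x} =
      Real.exp (-((extremalCoeff ν V r t).toReal / x)) :=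
  measureReal_lt_of_frechet
    (fun _ hy => measureReal_max_spectralProcess_le hV hV_int hξ r t hy) hx

lemma measureReal_spectralProcess_le (hV : ∀ t, Measurable (V t))
    (hV_int : ∀ t, ∫⁻ ω, V t ω ∂ν = 1) (hξ : IsPoissonPointProcess P ξ (invSqMeasure.prod ν))
    (t : T) {x : ℝ} (hx : 0 < x) :
    P.real {s | spectralProcess V ξ t s ≤ x} = Real.exp (-(1 / x)) := by
  simpa [extremalCoeff_self, hV_int] using measureReal_max_spectralProcess_le hV hV_int hξ t t hx

lemma measureReal_spectralProcess_lt (hV : ∀ t, Measurable (V t))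
    (hV_int : ∀ t, ∫⁻ ω, V t ω ∂ν = 1) (hξ : IsPoissonPointProcess P ξ (invSqMeasure.prod ν))
    (t : T) {x : ℝ} (hx : 0 < x) :
    P.real {s | spectralProcess V ξ t s < x} = Real.exp (-(1 / x)) :=
  measureReal_lt_of_frechet (fun _ hy => measureReal_spectralProcess_le hV hV_int hξ t hy) hx

/-! ### Tail correlation functions -/

lemma upperEndpoint_spectralProcess (hV : ∀ t, Measurable (V t))
    (hV_int : ∀ t, ∫⁻ ω, V t ω ∂ν = 1) (hξ : IsPoissonPointProcess P ξ (invSqMeasure.prod ν))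
    (t : T) : upperEndpoint P (spectralProcess V ξ t) = ⊤ := by
  refine EReal.eq_top_iff_forall_lt _ |>.2 fun y => ?_
  -- A level above `y` that is also positive, so that the Fréchet formula applies.
  have hy : (0 : ℝ) < max y 0 + 1 := by positivity
  refine lt_of_lt_of_le (b := ((max y 0 + 1 : ℝ) : EReal)) ?_ (le_sSup ?_)
  · exact_mod_cast (le_max_left y 0).trans_lt (lt_add_one _)
  · have h := measureReal_spectralProcess_le hV hV_int hξ t hy
    simp only [Set.mem_ofPred_eq, EReal.coe_le_coe_iff]
    rw [← ENNReal.toReal_lt_toReal (measure_ne_top _ _) (by simp), ← measureReal_def, h,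
      ENNReal.toReal_one, Real.exp_lt_one_iff]
    simpa using hy

lemma comap_coe_nhdsLT_top : comap ((↑) : ℝ → EReal) (𝓝[<] ⊤) = atTop := by
  have : Set.Iio (⊤ : EReal) = {⊤}ᶜ := by
    ext x
    simp [lt_top_iff_ne_top]
  rw [this, EReal.nhdsWithin_top, comap_map EReal.coe_injective]

/-- The numerator is `2 (1 - e^{-1/x}) - (1 - e^{-c/x})`, and `x (1 - e^{-b/x}) → b` is the
derivative of `a ↦ e^{-b a}` at `0` along `a = 1/x`. -/
lemma tendsto_exp_tail_ratio (c : ℝ) :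
    Tendsto (fun x : ℝ => (1 - Real.exp (-(1 / x)))⁻¹ *
      (1 - 2 * Real.exp (-(1 / x)) + Real.exp (-(c / x)))) atTop (𝓝 (2 - c)) := by
  have hd : ∀ b : ℝ, Tendsto (fun x : ℝ => x * (1 - Real.exp (-(b / x)))) atTop (𝓝 b) := by
    intro b
    have hder : HasDerivAt (fun a : ℝ => Real.exp (-(b * a))) (-b) 0 := by
      have := ((hasDerivAt_id (0 : ℝ)).const_mul b).neg.exp
      simpa using this
    have hslope := (hder.tendsto_slope_zero_right).comp tendsto_inv_atTop_nhdsGT_zero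
    have := hslope.neg
    simp only [neg_neg] at this
    refine this.congr fun x => ?_
    simp only [Function.comp_apply, smul_eq_mul, inv_inv, zero_add, mul_zero, neg_zero,
      Real.exp_zero, div_eq_mul_inv]
    ring
  have h := ((hd 1).inv₀ one_ne_zero).mul (((hd 1).const_mul 2).sub (hd c))
  have hval : (1 : ℝ)⁻¹ * (2 * 1 - c) = 2 - c := by norm_num
  rw [hval] at h
  refine h.congr' ?_
  filter_upwards [eventually_gt_atTop 0] with x hx
  rw [mul_inv, show 2 * (x * (1 - Real.exp (-(1 / x)))) - x * (1 - Real.exp (-(c / x))) =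
    x * (1 - 2 * Real.exp (-(1 / x)) + Real.exp (-(c / x))) by ring]
  field_simp

end Spectral

lemma isTailCorrelationFunction_spectralProcess {m : ℕ} {Ω S : Type*} [MeasurableSpace Ω]
    [MeasurableSpace S] {ν : Measure Ω} [SFinite ν] {V : EuclideanSpace ℝ (Fin m) → Ω → ℝ≥0}
    {P : Measure S} [IsProbabilityMeasure P] {ξ : ℕ → S → ℝ≥0 × Ω} (hV : ∀ t, Measurable (V t))
    (hV_int : ∀ t, ∫⁻ ω, V t ω ∂ν = 1) (hξ : IsPoissonPointProcess P ξ (invSqMeasure.prod ν)) :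
    IsTailCorrelationFunction P (spectralProcess V ξ)
      fun t => 2 - (extremalCoeff ν V 0 t).toReal := by
  intro t
  rw [upperEndpoint_spectralProcess hV hV_int hξ, comap_coe_nhdsLT_top]
  refine (tendsto_exp_tail_ratio _).congr' ?_
  filter_upwards [eventually_gt_atTop 0] with x hx
  have h0 := measurable_spectralProcess hV hξ 0
  have ht := measurable_spectralProcess hV hξ t
  have hm0 : MeasurableSet {s | spectralProcess V ξ 0 s < x} := measurableSet_lt h0 measurable_const
  have hmt : MeasurableSet {s | spectralProcess V ξ t s < x} := measurableSet_lt ht measurable_const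
  have hc0 : {s | x ≤ spectralProcess V ξ 0 s} = {s | spectralProcess V ξ 0 s < x}ᶜ := by
    ext; simp
  have hct : {s | x ≤ spectralProcess V ξ t s} = {s | spectralProcess V ξ t s < x}ᶜ := by
    ext; simp
  have hinter : {s | max (spectralProcess V ξ 0 s) (spectralProcess V ξ t s) < x} =
      {s | spectralProcess V ξ 0 s < x} ∩ {s | spectralProcess V ξ t s < x} := by
    ext; simp
  -- Inclusion-exclusion expresses the joint exceedance probability through the two marginals and
  -- the maximum.
  have hunion := measureReal_union_add_inter (μ := P) (s := {s | spectralProcess V ξ 0 s < x}) hmt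
  rw [← hinter, measureReal_max_spectralProcess_lt hV hV_int hξ 0 t hx,
    measureReal_spectralProcess_lt hV hV_int hξ 0 hx,
    measureReal_spectralProcess_lt hV hV_int hξ t hx] at hunion
  rw [measureReal_def, cond_apply (hc0 ▸ hm0.compl), ENNReal.toReal_mul, ENNReal.toReal_inv,
    ← measureReal_def, ← measureReal_def, hc0, hct, ← Set.compl_union,
    probReal_compl_eq_one_sub hm0, probReal_compl_eq_one_sub (hm0.union hmt),
    measureReal_spectralProcess_lt hV hV_int hξ 0 hx]
  congr 1
  linarith

/-- `exp (-θ)` is the distribution function of `max (X_r, X_t)` at level `1`. Replacing `t` by `t₀`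
costs a change of level by `ε` plus the probability of a deviation of at least `ε`, and at `t₀` the
distribution function is continuous in the level. -/
lemma continuous_extremalCoeff {m : ℕ} {Ω S : Type*} [MeasurableSpace Ω]
    [MeasurableSpace S] {ν : Measure Ω} [SFinite ν] {V : EuclideanSpace ℝ (Fin m) → Ω → ℝ≥0}
    {P : Measure S} [IsProbabilityMeasure P] {ξ : ℕ → S → ℝ≥0 × Ω} (hV : ∀ t, Measurable (V t))
    (hV_int : ∀ t, ∫⁻ ω, V t ω ∂ν = 1) (hξ : IsPoissonPointProcess P ξ (invSqMeasure.prod ν))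
    (hcont : IsStochasticallyContinuous P (spectralProcess V ξ)) (r : EuclideanSpace ℝ (Fin m)) :
    Continuous fun t => (extremalCoeff ν V r t).toReal := by
  suffices h : Continuous fun t => Real.exp (-((extremalCoeff ν V r t).toReal / 1)) by
    have h' := (h.log fun t => (Real.exp_pos _).ne').neg
    simpa [Pi.neg_def] using h'
  refine continuous_iff_continuousAt.2 fun t₀ => ?_
  have hscale : ContinuousAt
      (fun y : ℝ => Real.exp (-((extremalCoeff ν V r t₀).toReal / y))) 1 := by
    fun_prop (disch := norm_num)
  have hdev : ∀ ε, 0 < ε → Tendsto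
      (fun t => P.real {s | ε ≤ dist (spectralProcess V ξ t s) (spectralProcess V ξ t₀ s)})
      (𝓝 t₀) (𝓝 0) := tendstoInMeasure_iff_measureReal_dist.1 (hcont t₀)
  have hmax := fun t {x : ℝ} (hx : 0 < x) =>
    measureReal_max_spectralProcess_le hV hV_int hξ r t hx
  have hincl : ∀ t t' (x ε : ℝ),
      P.real {s | max (spectralProcess V ξ r s) (spectralProcess V ξ t s) ≤ x} ≤
      P.real {s | max (spectralProcess V ξ r s) (spectralProcess V ξ t' s) ≤ x + ε} +
      P.real {s | ε ≤ dist (spectralProcess V ξ t s) (spectralProcess V ξ t' s)} := by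
    intro t t' x ε
    refine le_trans (measureReal_mono fun s hs => ?_) (measureReal_union_le _ _)
    by_cases hd : ε ≤ dist (spectralProcess V ξ t s) (spectralProcess V ξ t' s)
    · exact Or.inr hd
    · left
      simp only [Set.mem_ofPred_eq, max_le_iff] at hs ⊢
      rw [not_le, Real.dist_eq] at hd
      have h1 := abs_lt.1 hd
      have h2 := (abs_nonneg _).trans_lt hd
      constructor <;> linarith
  have hup : Tendsto (fun ε : ℝ => 1 + ε) (𝓝[>] 0) (𝓝 1) := by
    have : ContinuousAt (fun ε : ℝ => 1 + ε) 0 := by fun_prop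
    simpa using this.tendsto.mono_left nhdsWithin_le_nhds
  have hdown : Tendsto (fun ε : ℝ => 1 - ε) (𝓝[>] 0) (𝓝 1) := by
    have : ContinuousAt (fun ε : ℝ => 1 - ε) 0 := by fun_prop
    simpa using this.tendsto.mono_left nhdsWithin_le_nhds
  refine tendsto_order.2 ⟨fun a ha => ?_, fun a ha => ?_⟩
  -- For the lower bound `t` and `t₀` swap roles, starting from level `1 - ε`; `ε < 1` keeps this
  -- level positive.
  · obtain ⟨ε, hε, hε0, hε1⟩ := (((hscale.tendsto.comp hdown).eventually_const_lt ha).and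
      (Ioo_mem_nhdsGT one_pos)).exists
    filter_upwards [(hdev ε hε0).eventually_lt_const (sub_pos.2 hε)] with t ht
    have := hincl t₀ t (1 - ε) ε
    simp only [dist_comm (spectralProcess V ξ t₀ _)] at this
    rw [hmax t₀ (sub_pos.2 hε1), sub_add_cancel, hmax t one_pos] at this
    simp only [Function.comp_apply] at ht
    linarith
  · obtain ⟨ε, hε, hε0⟩ := (((hscale.tendsto.comp hup).eventually_lt_const ha).and
      (self_mem_nhdsWithin)).exists
    replace hε0 : 0 < ε := hε0
    filter_upwards [(hdev ε hε0).eventually_lt_const (sub_pos.2 hε)] with t ht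
    have := hincl t t₀ 1 ε
    rw [hmax t₀ (by linarith), hmax t one_pos] at this
    simp only [Function.comp_apply] at ht
    linarith

/-! ### Turning bands -/

section TurningBands

variable {k d : ℕ} {Ω : Type*} [MeasurableSpace Ω] {ν : Measure Ω}
  {V : EuclideanSpace ℝ (Fin k) → Ω → ℝ≥0}

lemma Stiefel.proj_zero (A : Stiefel d k) : A.proj 0 = 0 := by
  simp [Stiefel.proj]

lemma Stiefel.proj_add (A : Stiefel d k) (s t : EuclideanSpace ℝ (Fin d)) :
    A.proj (s + t) = A.proj s + A.proj t := by
  simp [Stiefel.proj, Matrix.mulVec_add]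

lemma Stiefel.act_proj_mulVec (G : OrthGroup d) (A : Stiefel d k)
    (t : EuclideanSpace ℝ (Fin d)) :
    (G.act A).proj (WithLp.toLp 2 (G.1.mulVec t.ofLp)) = A.proj t := by
  have hG : G.1.transpose * G.1 = 1 := (Matrix.mem_orthogonalGroup_iff' (Fin d) ℝ).mp G.2
  simp only [Stiefel.proj, OrthGroup.act, Matrix.transpose_mul, Matrix.mulVec_mulVec,
    Matrix.mul_assoc, hG, Matrix.mul_one]

lemma Stiefel.continuous_proj_left (t : EuclideanSpace ℝ (Fin d)) :
    Continuous fun A : Stiefel d k => A.proj t :=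
  (Stiefel.continuous_proj d k).comp (Continuous.prodMk_right t)

lemma measurePreserving_act (hkd : k ≤ d) (G : OrthGroup d) :
    MeasurePreserving (fun A : Stiefel d k => G.act A) (stiefelUniform hkd)
      (stiefelUniform hkd) :=
  ⟨(OrthGroup.continuous_act_right G).measurable, stiefelUniform_map_act hkd G⟩

lemma measurable_turningBandsSpectral (hV : Measurable (Function.uncurry V))
    (t : EuclideanSpace ℝ (Fin d)) : Measurable (turningBandsSpectral V t) :=
  hV.comp (((Stiefel.continuous_proj_left t).measurable.comp measurable_snd).prodMk measurable_fst)

lemma exists_orthGroup_mulVec_eq {s t : EuclideanSpace ℝ (Fin d)} (h : ‖s‖ = ‖t‖) :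
    ∃ G : OrthGroup d, WithLp.toLp 2 (G.1.mulVec s.ofLp) = t := by
  -- For equal norms, the reflection in the hyperplane orthogonal to `s - t` sends `s` to `t`.
  let R := (ℝ ∙ (s - t))ᗮ.reflection
  let b := EuclideanSpace.basisFun (Fin d) ℝ
  refine ⟨⟨_, R.toMatrix_mem_unitaryGroup b b⟩, ?_⟩
  have hR : R s = t := Submodule.reflection_sub h
  rw [← hR]
  ext i
  exact congrFun (LinearMap.toMatrix_mulVec_repr b.toBasis b.toBasis _ s) i

lemma turningBands_eq_of_norm_eq (hkd : k ≤ d) (f : C(EuclideanSpace ℝ (Fin k), ℝ))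
    {s t : EuclideanSpace ℝ (Fin d)} (h : ‖s‖ = ‖t‖) :
    turningBands hkd f s = turningBands hkd f t := by
  obtain ⟨G, rfl⟩ := exists_orthGroup_mulVec_eq h
  change ∫ A, f (A.proj s) ∂(stiefelUniform hkd) = ∫ A, f (A.proj _) ∂(stiefelUniform hkd)
  conv_rhs => rw [← stiefelUniform_map_act hkd G]
  rw [integral_map (OrthGroup.continuous_act_right G).measurable.aemeasurable
    (show Continuous fun A : Stiefel d k => f (A.proj _) from f.continuous.comp
      (Stiefel.continuous_proj_left _)).measurable.aestronglyMeasurable]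
  simp only [Stiefel.act_proj_mulVec]

variable [SFinite ν]

lemma lintegral_turningBandsSpectral (hkd : k ≤ d) (hV : Measurable (Function.uncurry V))
    (hV_int : ∀ t, ∫⁻ ω, V t ω ∂ν = 1) (t : EuclideanSpace ℝ (Fin d)) :
    ∫⁻ p, turningBandsSpectral V t p ∂(ν.prod (stiefelUniform hkd)) = 1 := by
  rw [lintegral_prod_symm' _ (measurable_turningBandsSpectral hV t).coe_nnreal_ennreal]
  simp [turningBandsSpectral, hV_int]

lemma measurable_measure_exceedance_proj (hV : Measurable (Function.uncurry V))
    {ι : Type*} [Countable ι] (t : ι → EuclideanSpace ℝ (Fin d)) (x : ι → ℝ) :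
    Measurable fun A : Stiefel d k =>
      (invSqMeasure.prod ν) (exceedance V (fun i => A.proj (t i)) x) := by
  have hm : MeasurableSet ((MeasurableEquiv.prodAssoc (α := ℝ≥0) (β := Ω) (γ := Stiefel d k)) ⁻¹'
      exceedance (turningBandsSpectral V) t x) :=
    MeasurableEquiv.prodAssoc.measurable
      (measurableSet_exceedance (measurable_turningBandsSpectral hV) t x)
  exact measurable_measure_prodMk_right (μ := invSqMeasure.prod ν) hm

/-- After reassociating the product, the section at `A` of the exceedance set for `Y` is by
definition the one for `X` at the projected points. -/
lemma measure_exceedance_turningBandsSpectral (hkd : k ≤ d)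
    (hV : Measurable (Function.uncurry V)) {ι : Type*} [Countable ι]
    (t : ι → EuclideanSpace ℝ (Fin d)) (x : ι → ℝ) :
    (invSqMeasure.prod (ν.prod (stiefelUniform hkd)))
        (exceedance (turningBandsSpectral V) t x) =
      ∫⁻ A, (invSqMeasure.prod ν) (exceedance V (fun i => A.proj (t i)) x)
        ∂(stiefelUniform hkd) := by
  have hm := measurableSet_exceedance
    (measurable_turningBandsSpectral (d := d) hV) t x
  have hassoc := measurePreserving_prodAssoc invSqMeasure ν (stiefelUniform hkd)
  rw [← hassoc.measure_preimage hm.nullMeasurableSet,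
    Measure.prod_apply_symm (hassoc.measurable hm)]
  rfl

lemma extremalCoeff_turningBandsSpectral (hkd : k ≤ d) (hV : Measurable (Function.uncurry V))
    (t : EuclideanSpace ℝ (Fin d)) :
    extremalCoeff (ν.prod (stiefelUniform hkd)) (turningBandsSpectral V) 0 t =
      ∫⁻ A, extremalCoeff ν V 0 (A.proj t) ∂(stiefelUniform hkd) := by
  rw [extremalCoeff, lintegral_prod_symm' _ ((measurable_turningBandsSpectral hV 0).max
    (measurable_turningBandsSpectral hV t)).coe_nnreal_ennreal]
  simp only [turningBandsSpectral, Stiefel.proj_zero]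
  rfl

lemma turningBands_extremalCoeff (hkd : k ≤ d) (hV : Measurable (Function.uncurry V))
    (hV_int : ∀ t, ∫⁻ ω, V t ω ∂ν = 1)
    (hθ : Continuous fun t => (extremalCoeff ν V 0 t).toReal) (t : EuclideanSpace ℝ (Fin d)) :
    turningBands hkd ⟨fun t => 2 - (extremalCoeff ν V 0 t).toReal, continuous_const.sub hθ⟩ t =
      2 - (extremalCoeff (ν.prod (stiefelUniform hkd)) (turningBandsSpectral V) 0 t).toReal := by
  have hθA : Continuous fun A : Stiefel d k => (extremalCoeff ν V 0 (A.proj t)).toReal :=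
    hθ.comp (Stiefel.continuous_proj_left t)
  have hint : Integrable (fun A : Stiefel d k => (extremalCoeff ν V 0 (A.proj t)).toReal)
      (stiefelUniform hkd) :=
    hθA.integrable_of_hasCompactSupport (HasCompactSupport.of_compactSpace _)
  have hne := extremalCoeff_ne_top (fun t => hV.of_uncurry_left (x := t)) hV_int 0
  change ∫ A : Stiefel d k, (2 - (extremalCoeff ν V 0 (A.proj t)).toReal)
    ∂(stiefelUniform hkd) = _
  rw [integral_sub (integrable_const _) hint, extremalCoeff_turningBandsSpectral hkd hV,
    integral_toReal (f := fun A : Stiefel d k => extremalCoeff ν V 0 (A.proj t)) ?_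
      (ae_of_all _ fun A => (hne (A.proj t)).lt_top)]
  · simp
  -- Measurability of the `ℝ≥0∞`-valued coefficient comes from continuity of its real version, since
  -- it is finite.
  · refine hθA.measurable.ennreal_ofReal.aemeasurable.congr (ae_of_all _ fun A => ?_)
    exact ENNReal.ofReal_toReal (hne _)

end TurningBands

theorem lemma4p2 {k d : ℕ} (hk : 1 ≤ k) (hkd : k ≤ d)
    -- the spectral functions of `X`
    {Ω : Type*} [MeasurableSpace Ω] (ν : Measure Ω) [SFinite ν]
    (V : EuclideanSpace ℝ (Fin k) → Ω → ℝ≥0)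
    (hV_meas : Measurable (Function.uncurry V))
    (hV_int : ∀ t, ∫⁻ ω, (V t ω : ℝ≥0∞) ∂ν = 1)
    -- the Poisson points `(U_n, ω_n)` and the process `X`
    {S : Type*} [MeasurableSpace S] (P : Measure S) [IsProbabilityMeasure P]
    (ξ : ℕ → S → ℝ≥0 × Ω)
    (hξ : IsPoissonPointProcess P ξ (invSqMeasure.prod ν))
    (X : EuclideanSpace ℝ (Fin k) → S → ℝ)
    (hX : X = spectralProcess V ξ)
    (hX_cont : IsStochasticallyContinuous P X)
    -- the Poisson points `(U_n, (ω_n, A_n))` and the process `Y`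
    {S' : Type*} [MeasurableSpace S'] (P' : Measure S') [IsProbabilityMeasure P']
    (η : ℕ → S' → ℝ≥0 × (Ω × Stiefel d k))
    (hη : IsPoissonPointProcess P' η (invSqMeasure.prod (ν.prod (stiefelUniform hkd))))
    (Y : EuclideanSpace ℝ (Fin d) → S' → ℝ)
    (hY : Y = spectralProcess (turningBandsSpectral V) η) :
    -- the suprema defining `Y` are almost surely finite
    (∀ t, ∀ᵐ s ∂P', BddAbove (Set.range fun n =>
      ((η n s).1 : ℝ) * (V ((η n s).2.2.proj t) (η n s).2.1 : ℝ))) ∧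
    -- a)
    (IsStationaryProcess P X → IsStationaryProcess P' Y) ∧
    -- b)
    (∀ G : OrthGroup d,
      SameLaw P' P' (fun t => Y (WithLp.toLp 2 (G.1.mulVec t.ofLp))) Y) ∧
    -- c)
    (IsStationaryProcess P X →
      ∃ χ : C(EuclideanSpace ℝ (Fin k), ℝ),
        IsTailCorrelationFunction P X χ ∧
        IsTailCorrelationFunction P' Y (turningBands hkd χ) ∧
        ∀ s t : EuclideanSpace ℝ (Fin d), ‖s‖ = ‖t‖ →
          turningBands hkd χ s = turningBands hkd χ t) := by
  subst hX hY
  have hV : ∀ t, Measurable (V t) := fun t => hV_meas.comp measurable_prodMk_left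
  have hW := measurable_turningBandsSpectral (d := d) hV_meas
  have hW_int := lintegral_turningBandsSpectral (ν := ν) hkd hV_meas hV_int
  have hW_fin : ∀ t, ∫⁻ p, turningBandsSpectral V t p ∂(ν.prod (stiefelUniform hkd)) ≠ ∞ :=
    fun t => by simp [hW_int]
  have hV_fin : ∀ t, ∫⁻ ω, V t ω ∂ν ≠ ∞ := fun t => by simp [hV_int]
  refine ⟨fun t => ae_bddAbove_spectral (hW t) (hW_fin t) hη, fun hstat h => ?_, fun G => ?_,
    fun _ => ?_⟩
  · refine sameLaw_spectralProcess_comp hW hW_fin hη (fun t => t + h) id fun I x => ?_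
    rw [measure_exceedance_turningBandsSpectral hkd hV_meas,
      measure_exceedance_turningBandsSpectral hkd hV_meas]
    -- The integrands agree for every single `A`: compare void probabilities and use stationarity of
    -- `X` with shift `Aᵀ h`.
    refine lintegral_congr fun A => voidProb_injective ?_
    rw [← measure_spectralProcess_le hV hV_fin hξ, ← measure_spectralProcess_le hV hV_fin hξ]
    simp only [Stiefel.proj_add, id]
    exact (hstat (A.proj h)).measure_le_eq (fun i : I => A.proj i) x
  · let f : EuclideanSpace ℝ (Fin d) → EuclideanSpace ℝ (Fin d) :=
      fun t => WithLp.toLp 2 (G.1.mulVec t.ofLp)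
    refine sameLaw_spectralProcess_comp hW hW_fin hη f id fun I x => ?_
    rw [measure_exceedance_turningBandsSpectral hkd hV_meas,
      measure_exceedance_turningBandsSpectral hkd hV_meas]
    -- Substituting `A ↦ G A` on the rotated side cancels `G`, as `(G A)ᵀ G t = Aᵀ t`.
    rw [← (measurePreserving_act hkd G).lintegral_comp
      (measurable_measure_exceedance_proj hV_meas _ x)]
    simp only [f, Stiefel.act_proj_mulVec, id]
  · have hθ := continuous_extremalCoeff hV hV_int hξ hX_cont 0
    refine ⟨⟨fun t => 2 - (extremalCoeff ν V 0 t).toReal, by fun_prop⟩,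
      isTailCorrelationFunction_spectralProcess hV hV_int hξ, fun t => ?_,
      fun s t => turningBands_eq_of_norm_eq hkd _⟩
    rw [turningBands_extremalCoeff hkd hV_meas hV_int hθ]
    exact isTailCorrelationFunction_spectralProcess hW hW_int hη t
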